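/- Let $L$ be a finite-dimensional Lie algebra over a field $F$. For $x\in L$ let $\mathrm{sol}_L(x)=\{y\in L : \text{the Lie subalgebra } \langle x,y\rangle \text{ of } L \text{ generated by } x \text{ and } y \text{ is solvable}\}$, and call $L$ an S-Lie algebra if $\mathrm{sol}_L(x)$ is a Lie subalgebra of $L$ for every $x\in L$. (1) If $L$ is solvable, then $L$ is an S-Lie algebra; in fact $\mathrm{sol}_L(x)=L$ for every $x\in L$. (2) Conversely, assume that $F$ is algebraically closed of characteristic zero. If $L$ is an S-Lie algebra, then $L$ is solvable. In particular, if $F$ is algebraically closed of characteristic zero, then $L$ is solvable if and only if $L$ is an S-Lie algebra. -/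

import Mathlib

/-- The solvabilizer `sol_L(h)`: the set of all `x` in `L` such that the Lie subalgebra
generated by `h` and `x` is solvable. -/
def solvabilizer (F : Type*) {L : Type*} [Field F] [LieRing L] [LieAlgebra F L] (h : L) : Set L :=
  {x : L | LieAlgebra.IsSolvable (LieSubalgebra.lieSpan F L {h, x})}

/-- `L` is an S-Lie algebra if `sol_L(x)` is (the underlying set of) a Lie subalgebra of `L`
for every `x` in `L`. -/
def IsSLieAlgebra (F L : Type*) [Field F] [LieRing L] [LieAlgebra F L] : Prop :=
  ∀ x : L, ∃ K : LieSubalgebra F L, (K : Set L) = solvabilizer F x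

/-! If `L` is not solvable, its quotient by the radical is nonzero with trivial radical, so over an
algebraically closed field of characteristic zero it contains an `sl₂` triple `h, e, f`. Both `e`
and `f` are eigenvectors of `ad h`, so each lies in the solvabilizer of `h`; but `h` and `e + f`
recover the whole triple, so `e + f` does not. Thus this solvabilizer is not closed under addition.
By `mem_solvabilizer_iff_map` solvabilizers pull back along maps with solvable kernel, so the
failure lifts to `L`. -/

open LieAlgebra

section Extensions

variable {R L L' : Type*} [CommRing R] [LieRing L] [LieAlgebra R L] [LieRing L'] [LieAlgebra R L']

/-- An extension of a solvable Lie algebra by a solvable Lie algebra is solvable. -/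
theorem LieHom.isSolvable_of_isSolvable_ker (f : L →ₗ⁅R⁆ L') [IsSolvable f.ker] [IsSolvable L'] :
    IsSolvable L := by
  obtain ⟨k, hk⟩ := IsSolvable.solvable R L'
  obtain ⟨l, hl⟩ := IsSolvable.solvable R f.ker
  have hle : derivedSeries R L k ≤ f.ker := by
    rw [← LieIdeal.map_eq_bot_iff, ← le_bot_iff, ← hk]
    exact LieIdeal.derivedSeries_map_le k
  rw [LieIdeal.derivedSeries_eq_bot_iff] at hl
  refine IsSolvable.mk (R := R) (k := l + k) ?_
  rw [derivedSeries_def, derivedSeriesOfIdeal_add, ← le_bot_iff, ← hl]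
  exact derivedSeriesOfIdeal_mono hle l

/-- A Lie subalgebra is solvable as soon as its image under a homomorphism with solvable kernel
lies in a solvable subalgebra. -/
theorem LieSubalgebra.isSolvable_of_map_le (f : L →ₗ⁅R⁆ L') [IsSolvable f.ker]
    (S : LieSubalgebra R L) (T : LieSubalgebra R L') [IsSolvable T] (h : S.map f ≤ T) :
    IsSolvable S := by
  let g : S →ₗ⁅R⁆ T :=
    { toFun := fun x => ⟨f x, h ⟨x, x.2, rfl⟩⟩
      map_add' := fun x y => by ext; simp
      map_smul' := fun r x => by ext; simp
      map_lie' := fun {x y} => by ext; simp }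
  have hg (x : g.ker) : f (x : S) = 0 := congrArg Subtype.val (LieHom.mem_ker.mp x.2)
  let i : g.ker →ₗ⁅R⁆ f.ker :=
    { toFun := fun x => ⟨(x : S), LieHom.mem_ker.mpr (hg x)⟩
      map_add' := fun x y => rfl
      map_smul' := fun r x => rfl
      map_lie' := fun {x y} => rfl }
  have hi : Function.Injective i := fun x y hxy =>
    Subtype.ext (Subtype.ext (congrArg (fun z : f.ker => (z : L)) hxy))
  have : IsSolvable g.ker := hi.lieAlgebra_isSolvable
  exact g.isSolvable_of_isSolvable_ker

/-- The projection of a Lie algebra onto its quotient by an ideal, as a homomorphism of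
Lie algebras. -/
def LieIdeal.quotientHom (I : LieIdeal R L) : L →ₗ⁅R⁆ L ⧸ I :=
  { (LieSubmodule.Quotient.mk' I : L →ₗ[R] L ⧸ I) with
    map_lie' := fun {_ _} => rfl }

theorem LieIdeal.quotientHom_surjective (I : LieIdeal R L) : Function.Surjective I.quotientHom :=
  LieSubmodule.Quotient.surjective_mk' I

theorem LieIdeal.ker_quotientHom (I : LieIdeal R L) : I.quotientHom.ker = I := by
  ext x
  rw [LieHom.mem_ker]
  exact LieSubmodule.Quotient.mk_eq_zero I

/-- The quotient of a Lie algebra by its radical has trivial radical. -/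
theorem LieAlgebra.hasTrivialRadical_quotient_radical [IsNoetherian R L] :
    HasTrivialRadical R (L ⧸ radical R L) := by
  let f := LieIdeal.quotientHom (radical R L)
  have hf : f.ker = radical R L := LieIdeal.ker_quotientHom _
  have : IsSolvable f.ker := by rw [hf]; infer_instance
  refine hasTrivialRadical_of_no_solvable_ideals fun I hI => ?_
  have : IsSolvable I.toLieSubalgebra := hI
  -- The preimage of a solvable ideal is solvable because the kernel is; hence it lies in the
  -- radical, which is that kernel, and `I` vanishes.
  have hJ : IsSolvable (I.comap f) :=
    LieSubalgebra.isSolvable_of_map_le f (I.comap f).toLieSubalgebra I.toLieSubalgebra <| by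
      rintro _ ⟨x, hx, rfl⟩
      exact LieIdeal.mem_comap.mp hx
  replace hJ := ((LieIdeal.solvable_iff_le_radical R L _).mp hJ).trans hf.ge
  rw [LieSubmodule.eq_bot_iff]
  intro y hy
  obtain ⟨x, rfl⟩ := LieIdeal.quotientHom_surjective _ y
  exact LieHom.mem_ker.mp (hJ (LieIdeal.mem_comap.mpr hy))

end Extensions

section TwoGenerated

variable {R L : Type*} [CommRing R] [LieRing L] [LieAlgebra R L]

/-- Two elements `x`, `y` with `⁅x, y⁆` a multiple of `y` generate a solvable subalgebra. -/
theorem LieSubalgebra.isSolvable_lieSpan_pair {x y : L} {c : R} (h : ⁅x, y⁆ = c • y) :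
    IsSolvable (lieSpan R L {x, y}) := by
  have h' : ⁅y, x⁆ = -(c • y) := by rw [← lie_skew, h]
  -- This makes the span of `x` and `y` closed under the bracket, with its derived algebra inside
  -- the multiples of `y`, hence abelian.
  have lie_comb (a b a' b' : R) :
      ⁅a • x + b • y, a' • x + b' • y⁆ = ((a * b' - b * a') * c) • y := by
    simp only [lie_add, add_lie, lie_smul, smul_lie, lie_self, h, h']
    module
  have mem_comb : ∀ u ∈ lieSpan R L {x, y}, ∃ a b : R, u = a • x + b • y := by
    intro u hu
    induction hu using lieSpan_induction with
    | mem u hu =>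
      rcases hu with rfl | rfl
      · exact ⟨1, 0, by simp⟩
      · exact ⟨0, 1, by simp⟩
    | zero => exact ⟨0, 0, by simp⟩
    | add u v _ _ hu hv =>
      obtain ⟨a, b, rfl⟩ := hu
      obtain ⟨a', b', rfl⟩ := hv
      exact ⟨a + a', b + b', by module⟩
    | smul r u _ hu =>
      obtain ⟨a, b, rfl⟩ := hu
      exact ⟨r * a, r * b, by module⟩
    | lie u v _ _ hu hv =>
      obtain ⟨a, b, rfl⟩ := hu
      obtain ⟨a', b', rfl⟩ := hv
      exact ⟨0, _, by rw [lie_comb, zero_smul, zero_add]⟩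
  have derived_le : ∀ u ∈ derivedSeries R (lieSpan R L {x, y}) 1, ∃ b : R, (u : L) = b • y := by
    intro u hu
    replace hu := (coe_derivedSeries_one_eq R (lieSpan R L {x, y})).le hu
    induction hu using Submodule.span_induction with
    | mem u hu =>
      obtain ⟨v, w, rfl⟩ := hu
      obtain ⟨a, b, hv⟩ := mem_comb v v.2
      obtain ⟨a', b', hw⟩ := mem_comb w w.2
      exact ⟨_, by rw [LieSubalgebra.coe_bracket, hv, hw, lie_comb]⟩
    | zero => exact ⟨0, by simp⟩
    | add u v _ _ hu hv =>
      obtain ⟨b, hu⟩ := hu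
      obtain ⟨b', hv⟩ := hv
      exact ⟨b + b', by rw [AddMemClass.coe_add, hu, hv, add_smul]⟩
    | smul r u _ hu =>
      obtain ⟨b, hu⟩ := hu
      exact ⟨r * b, by rw [SetLike.val_smul, hu, mul_smul]⟩
  refine IsSolvable.mk (R := R) (k := 2) ?_
  rw [derivedSeries_def, derivedSeriesOfIdeal_succ, ← derivedSeries_def, LieSubmodule.lie_eq_bot_iff]
  intro u hu v hv
  obtain ⟨b, hu⟩ := derived_le u hu
  obtain ⟨b', hv⟩ := derived_le v hv
  ext
  simp [hu, hv]

end TwoGenerated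

section SlTwo

variable {F L : Type*} [Field F] [LieRing L] [LieAlgebra F L]

/-- Away from characteristic two, a solvable Lie algebra contains no `sl₂` triple. -/
theorem IsSl2Triple.not_isSolvable (h2 : (2 : F) ≠ 0) {h e f : L} (t : IsSl2Triple h e f) :
    ¬ IsSolvable L := by
  intro hL
  obtain ⟨k, hk⟩ := IsSolvable.solvable F L
  -- Up to the invertible factors `±2`, each member of the triple is a bracket of two members, so
  -- the triple survives in every derived term.
  have key (n : ℕ) : h ∈ derivedSeries F L n ∧ e ∈ derivedSeries F L n ∧
      f ∈ derivedSeries F L n := by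
    induction n with
    | zero => simp [derivedSeries_def]
    | succ n ih =>
      obtain ⟨hh, he, hf⟩ := ih
      rw [derivedSeries_def, derivedSeriesOfIdeal_succ, ← derivedSeries_def]
      refine ⟨?_, ?_, ?_⟩
      · rw [← t.lie_e_f]
        exact LieSubmodule.lie_mem_lie he hf
      · rw [← inv_smul_smul₀ h2 e, ← t.lie_h_e_smul F]
        exact SMulMemClass.smul_mem _ (LieSubmodule.lie_mem_lie hh he)
      · rw [← inv_smul_smul₀ h2 f, ← neg_neg ((2 : F) • f), ← t.lie_lie_smul_f F]
        exact SMulMemClass.smul_mem _ (neg_mem (LieSubmodule.lie_mem_lie hh hf))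
  have hh := (key k).1
  rw [hk, LieSubmodule.mem_bot] at hh
  exact t.h_ne_zero hh

/-- Away from characteristic two, the elements `h` and `e + f` of an `sl₂` triple generate a
subalgebra that is not solvable. -/
theorem IsSl2Triple.not_isSolvable_lieSpan (h2 : (2 : F) ≠ 0) {h e f : L}
    (t : IsSl2Triple h e f) : ¬ IsSolvable (LieSubalgebra.lieSpan F L {h, e + f}) := by
  set S := LieSubalgebra.lieSpan F L {h, e + f}
  have hh : h ∈ S := LieSubalgebra.subset_lieSpan (by simp)
  have hs : e + f ∈ S := LieSubalgebra.subset_lieSpan (by simp)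
  -- Half of `⁅h, e + f⁆ = 2(e - f)`.
  have hd : e - f ∈ S := by
    have hl := S.smul_mem (2 : F)⁻¹ (S.lie_mem hh hs)
    rwa [lie_add, t.lie_h_e_smul F, t.lie_lie_smul_f F, ← sub_eq_add_neg, ← smul_sub,
      inv_smul_smul₀ h2] at hl
  have he : e ∈ S := by
    have := S.smul_mem (2 : F)⁻¹ (add_mem hs hd)
    rwa [show e + f + (e - f) = (2 : F) • e by module, inv_smul_smul₀ h2] at this
  have hf : f ∈ S := by simpa using sub_mem hs he
  have tS : IsSl2Triple (⟨h, hh⟩ : S) ⟨e, he⟩ ⟨f, hf⟩ :=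
    { h_ne_zero := fun h0 => t.h_ne_zero (congrArg Subtype.val h0)
      lie_e_f := Subtype.ext t.lie_e_f
      lie_h_e_nsmul := Subtype.ext (by simpa using t.lie_h_e_nsmul)
      lie_h_f_nsmul := Subtype.ext (by simpa using t.lie_h_f_nsmul) }
  exact tS.not_isSolvable h2

/-- A nonzero Lie algebra with trivial radical over an algebraically closed field of
characteristic zero contains an `sl₂` triple. -/
theorem LieAlgebra.exists_isSl2Triple [IsAlgClosed F] [CharZero F] [FiniteDimensional F L]
    [HasTrivialRadical F L] [Nontrivial L] : ∃ h e f : L, IsSl2Triple h e f := by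
  obtain ⟨x, hx⟩ := exists_isCartanSubalgebra_engel F L
  set H := LieSubalgebra.engel F x
  by_cases hα : ∃ α : LieModule.Weight F H L, α.IsNonZero
  · obtain ⟨α, hα⟩ := hα
    obtain ⟨h, e, f, t, -, -⟩ := IsKilling.exists_isSl2Triple_of_weight_isNonZero hα
    exact ⟨h, e, f, t⟩
  -- The roots span the dual of `H`, so without roots `H = 0`. But a Cartan subalgebra is
  -- self-normalizing, and the normalizer of `0` is all of `L`.
  exfalso
  have htop := IsKilling.span_weight_isNonZero_eq_top F L H
  rw [Set.eq_empty_of_forall_notMem (s := {α : LieModule.Weight F H L | α.IsNonZero})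
    (fun α h => hα ⟨α, h⟩), Set.image_empty, Submodule.span_empty] at htop
  have hdual : Subsingleton (Module.Dual F H) :=
    (Submodule.subsingleton_iff F).mp (subsingleton_of_bot_eq_top htop)
  have hH : Subsingleton H := (Module.subsingleton_dual_iff F).mp hdual
  have hbot : H = ⊥ := by
    rw [LieSubalgebra.eq_bot_iff]
    intro y hy
    exact congrArg Subtype.val (Subsingleton.elim (⟨y, hy⟩ : H) 0)
  obtain ⟨y, hy⟩ := exists_ne (0 : L)
  have hyn : y ∈ H.normalizer := by
    rw [LieSubalgebra.mem_normalizer_iff]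
    intro z hz
    rw [hbot, LieSubalgebra.mem_bot] at hz
    simp [hz]
  rw [hx.self_normalizing, hbot, LieSubalgebra.mem_bot] at hyn
  exact hy hyn

end SlTwo

section SLieAlgebra

variable {F L : Type*} [Field F] [LieRing L] [LieAlgebra F L]

theorem solvabilizer_eq_univ [IsSolvable L] (x : L) : solvabilizer F x = Set.univ :=
  Set.eq_univ_of_forall fun _ =>
    Function.Injective.lieAlgebra_isSolvable (f := LieSubalgebra.incl _) Subtype.val_injective

theorem IsSLieAlgebra.of_isSolvable [IsSolvable L] : IsSLieAlgebra F L :=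
  fun x => ⟨⊤, by rw [solvabilizer_eq_univ]; rfl⟩

variable {L' : Type*} [LieRing L'] [LieAlgebra F L']

/-- The solvabilizer of `x` is the preimage of the solvabilizer of its image under a homomorphism
with solvable kernel. -/
theorem mem_solvabilizer_iff_map (φ : L →ₗ⁅F⁆ L') [IsSolvable φ.ker] {x y : L} :
    y ∈ solvabilizer F x ↔ φ y ∈ solvabilizer F (φ x) := by
  have hmap : (LieSubalgebra.lieSpan F L {x, y}).map φ =
      LieSubalgebra.lieSpan F L' {φ x, φ y} := by
    rw [LieSubalgebra.map_lieSpan, Set.image_pair]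
  constructor
  · intro (h : LieAlgebra.IsSolvable _)
    change LieAlgebra.IsSolvable (LieSubalgebra.lieSpan F L' {φ x, φ y})
    have hrange : (LieSubalgebra.lieSpan F L {x, y}).map φ =
        (φ.comp (LieSubalgebra.lieSpan F L {x, y}).incl).range := by
      ext
      simp
    rw [← hmap, hrange]
    infer_instance
  · intro (h : LieAlgebra.IsSolvable _)
    exact LieSubalgebra.isSolvable_of_map_le φ _ _ hmap.le

/-- An S-Lie algebra does not map onto a Lie algebra containing an `sl₂` triple with solvable
kernel. -/
theorem IsSLieAlgebra.not_isSl2Triple (h2 : (2 : F) ≠ 0) (hS : IsSLieAlgebra F L)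
    (φ : L →ₗ⁅F⁆ L') [IsSolvable φ.ker] (hφ : Function.Surjective φ) {h e f : L'} :
    ¬ IsSl2Triple h e f := by
  intro t
  obtain ⟨h, rfl⟩ := hφ h
  obtain ⟨e, rfl⟩ := hφ e
  obtain ⟨f, rfl⟩ := hφ f
  obtain ⟨K, hK⟩ := hS h
  have mem_K {y : L} : y ∈ K ↔ φ y ∈ solvabilizer F (φ h) := by
    rw [← mem_solvabilizer_iff_map, ← hK, SetLike.mem_coe]
  have he : e ∈ K := mem_K.mpr (LieSubalgebra.isSolvable_lieSpan_pair (t.lie_h_e_smul F))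
  have hf : f ∈ K := mem_K.mpr <| LieSubalgebra.isSolvable_lieSpan_pair (c := -2) <| by
    rw [t.lie_lie_smul_f F, neg_smul]
  have hef := mem_K.mp (add_mem he hf)
  rw [map_add] at hef
  exact t.not_isSolvable_lieSpan h2 hef

theorem IsSLieAlgebra.isSolvable [IsAlgClosed F] [CharZero F] [FiniteDimensional F L]
    (hS : IsSLieAlgebra F L) : IsSolvable L := by
  let φ := LieIdeal.quotientHom (radical F L)
  have hφ : Function.Surjective φ := LieIdeal.quotientHom_surjective _
  have : IsSolvable φ.ker := by
    rw [LieIdeal.ker_quotientHom]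
    infer_instance
  have := hasTrivialRadical_quotient_radical (R := F) (L := L)
  have : FiniteDimensional F (L ⧸ radical F L) :=
    Module.Finite.of_surjective (φ : L →ₗ[F] L ⧸ radical F L) hφ
  rcases subsingleton_or_nontrivial (L ⧸ radical F L) with _ | _
  · exact φ.isSolvable_of_isSolvable_ker
  · obtain ⟨h, e, f, t⟩ := exists_isSl2Triple (F := F) (L := L ⧸ radical F L)
    exact absurd t (hS.not_isSl2Triple two_ne_zero φ hφ)

end SLieAlgebra

theorem mainTheorem3 (F L : Type*) [Field F] [LieRing L] [LieAlgebra F L]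
    [FiniteDimensional F L] :
    (LieAlgebra.IsSolvable L →
      IsSLieAlgebra F L ∧ ∀ x : L, solvabilizer F x = Set.univ) ∧
    (IsAlgClosed F → CharZero F → IsSLieAlgebra F L → LieAlgebra.IsSolvable L) ∧
    (IsAlgClosed F → CharZero F → (LieAlgebra.IsSolvable L ↔ IsSLieAlgebra F L)) :=
  ⟨fun _ => ⟨.of_isSolvable, solvabilizer_eq_univ⟩, fun _ _ hS => hS.isSolvable,
    fun _ _ => ⟨fun _ => .of_isSolvable, fun hS => hS.isSolvable⟩⟩
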